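/- Let $n\ge 2$ and let $\mathbb M^n$ be $n$-dimensional Minkowski space, $\mathcal L_0$ the identity component of $\mathrm O(n-1,1)$, and $\mathcal P_0$ the group of affine bijections of $\mathbb M^n$ with linear part in $\mathcal L_0$ (the Poincaré group). Let $\Omega$ be the set of locally finite subsets of $\mathbb M^n$, with the $\sigma$-algebra generated by the maps $\omega\mapsto|\omega\cap B|$, $B$ Borel, and let $\mu$ be the law on $\Omega$ of the Poisson process of density $\rho>0$: if $B$ is a Borel set of finite volume $V$, then $|\omega\cap B|$ is Poisson distributed with mean $\rho V$, and the numbers of points in pairwise disjoint such sets are independent. The group $\mathcal P_0$ acts on $\mathbb M^n$, on $\Omega$ pointwise, and, through its linear part, on the hyperboloid $\mathcal H$ of future-directed unit timelike vectors, on the hyperboloid $\mathcal S$ of unit spacelike vectors, and on $(\mathcal H\sqcup\mathcal S)^k/\Gamma$, where $k\ge1$ and the group $\Gamma\le \mathfrak S_k$ permutes the entries (with the quotient $\sigma$-algebra). For a measure space $(X,\nu)$ and a measurable space $Y$ on which $\mathcal P_0$ acts, and a subgroup $G\le\mathcal P_0$, say that $(X,\nu)$ *$G$-equivariantly determines a point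 of $Y$* if there are a measurable set $A\subseteq X$ with $\nu(A)\neq0$ and a measurable map $D:A\to Y$ such that $D(gx)=g\,D(x)$ whenever $g\in G$, $x\in A$ and $gx\in A$. (This includes everywhere defined equivariant maps, and equivariant maps defined on an invariant set of nonzero measure.) Then: 1. (No preferred location.) $(\Omega,\mu)$ does not $\mathcal P_0$-equivariantly determine a point of $\mathbb M^n$; it does not do so even when $\mathcal P_0$ is replaced by the subgroup of translations. 2. (The results on directions hold for the Poincaré group as well as for the Lorentz group.) Let $Y$ be $\mathcal H$, or $\mathcal S$, or $(\mathcal H\sqcup\mathcal S)^k/\Gamma$ for some $k\ge1$ and $\Gamma\le\mathfrak S_k$. Then - (a) $(\Omega,\mu)$ does not $\mathcal P_0$-equivariantly determine a point of $Y$; - (b) for every $x\in\mathbb M^n$, $(\Omega,\mu)$ does not $G_x$-equivariantly determine a point of $Y$, where $G_x\cong\mathcal L_0$ is the stabilizer of $x$ in $\mathcal P_0$; - (c) $(\Omega\times\mathbb M^n,\ \mu\otimes\mathrm{vol})$ does not $\mathcal P_0$-equivariantly determine a point of $Y$; that is, there is no rule $(\omega,x)\mapsto D(\omega,x)\in Y$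 for choosing directions at variable points $x$ with $D(g\omega,gx)=g\,D(\omega,x)$. -/

import Mathlib

open MeasureTheory ProbabilityTheory

noncomputable section

namespace Sprinkling

/-- Minkowski space of dimension `d + 1`, in inertial coordinates; coordinate `0` is time. Topology,
Borel sets and the volume measure are the usual ones of `ℝ^(d+1)`. -/
abbrev Minkowski (d : ℕ) : Type := Fin (d + 1) → ℝ

/-- The Minkowski inner product, of signature `(-, +, …, +)`. -/
def eta {d : ℕ} (v w : Minkowski d) : ℝ := -(v 0 * w 0) + ∑ i : Fin d, v i.succ * w i.succ

/-- The full Lorentz group `O(d, 1)`, with the topology of invertible matrices. -/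
def fullLorentz (d : ℕ) : Subgroup (GL (Fin (d + 1)) ℝ) where
  carrier := {L | ∀ v w : Minkowski d,
    eta ((L : Matrix (Fin (d + 1)) (Fin (d + 1)) ℝ).mulVec v)
      ((L : Matrix (Fin (d + 1)) (Fin (d + 1)) ℝ).mulVec w) = eta v w}
  one_mem' := by intro v w; simp
  mul_mem' := by
    intro a b ha hb v w
    simp only [Units.val_mul, ← Matrix.mulVec_mulVec]
    rw [ha, hb]
  inv_mem' := by
    intro a ha v w
    have h := ha ((↑(a⁻¹) : Matrix (Fin (d + 1)) (Fin (d + 1)) ℝ).mulVec v)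
      ((↑(a⁻¹) : Matrix (Fin (d + 1)) (Fin (d + 1)) ℝ).mulVec w)
    simpa only [Matrix.mulVec_mulVec, ← Units.val_mul, mul_inv_cancel, Units.val_one,
      Matrix.one_mulVec] using h.symm

/-- The Lorentz group: the connected component of the identity in `O(d, 1)`. -/
def lorentz (d : ℕ) : Subgroup (GL (Fin (d + 1)) ℝ) :=
  (Subgroup.connectedComponentOfOne (fullLorentz d)).map (fullLorentz d).subtype

theorem eta_lorentz {d : ℕ} {L : GL (Fin (d + 1)) ℝ} (hL : L ∈ lorentz d) (v w : Minkowski d) :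
    eta ((L : Matrix (Fin (d + 1)) (Fin (d + 1)) ℝ).mulVec v)
      ((L : Matrix (Fin (d + 1)) (Fin (d + 1)) ℝ).mulVec w) = eta v w := by
  obtain ⟨M, -, rfl⟩ := hL
  exact M.2 v w

theorem time_ne_zero {d : ℕ} {v : Minkowski d} (hv : eta v v = -1) : v 0 ≠ 0 := by
  intro h
  have : 0 ≤ ∑ i : Fin d, v i.succ * v i.succ := Finset.sum_nonneg fun i _ => mul_self_nonneg _
  simp only [eta, h] at hv
  linarith

/-- Lorentz transformations in the identity component preserve the time orientation. -/
theorem future_lorentz {d : ℕ} {L : GL (Fin (d + 1)) ℝ} (hL : L ∈ lorentz d) {v : Minkowski d}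
    (hv : eta v v = -1) (h0 : 0 < v 0) :
    0 < (L : Matrix (Fin (d + 1)) (Fin (d + 1)) ℝ).mulVec v 0 := by
  obtain ⟨M, hM, rfl⟩ := hL
  let f : fullLorentz d → ℝ := fun N =>
    ((N : GL (Fin (d + 1)) ℝ) : Matrix (Fin (d + 1)) (Fin (d + 1)) ℝ).mulVec v 0
  have hf : Continuous f := by
    have h1 : Continuous fun N : fullLorentz d =>
        ((N : GL (Fin (d + 1)) ℝ) : Matrix (Fin (d + 1)) (Fin (d + 1)) ℝ) :=
      Units.continuous_val.comp continuous_subtype_val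
    exact (continuous_apply 0).comp (h1.matrix_mulVec continuous_const)
  have hne : ∀ N, f N ≠ 0 := fun N => time_ne_zero ((N.2 v v).trans hv)
  have h1 : 0 < f 1 := by simpa [f] using h0
  have hM' : M ∈ connectedComponent (1 : fullLorentz d) := hM
  have hpre := (isPreconnected_connectedComponent (x := (1 : fullLorentz d))).image f
    hf.continuousOn
  by_contra hneg
  have hle : f M ≤ 0 := not_lt.mp hneg
  obtain ⟨N, -, hN⟩ := hpre.ordConnected.out (Set.mem_image_of_mem f hM')
    (Set.mem_image_of_mem f mem_connectedComponent) ⟨hle, h1.le⟩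
  exact hne N hN

/-- The Poincaré group (its identity component): the affine bijections of Minkowski space whose
linear part lies in the Lorentz group. -/
def poincareSubgroup (d : ℕ) : Subgroup (Minkowski d ≃ᵃ[ℝ] Minkowski d) where
  carrier := {g | ∃ L ∈ lorentz d, ∀ v : Minkowski d,
    g.linear v = (L : Matrix (Fin (d + 1)) (Fin (d + 1)) ℝ).mulVec v}
  one_mem' := ⟨1, one_mem _, fun v => by simp [AffineEquiv.one_def]⟩
  mul_mem' := by
    rintro a b ⟨L, hL, hLa⟩ ⟨K, hK, hKb⟩
    refine ⟨L * K, mul_mem hL hK, fun v => ?_⟩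
    have : (a * b).linear v = a.linear (b.linear v) := rfl
    rw [this, hKb, hLa, Units.val_mul, Matrix.mulVec_mulVec]
  inv_mem' := by
    rintro a ⟨L, hL, hLa⟩
    refine ⟨L⁻¹, inv_mem hL, fun v => ?_⟩
    have : (a⁻¹).linear v = a.linear.symm v := rfl
    rw [this, LinearEquiv.symm_apply_eq, hLa, Matrix.mulVec_mulVec, ← Units.val_mul,
      mul_inv_cancel, Units.val_one, Matrix.one_mulVec]

abbrev Poincare (d : ℕ) : Type := poincareSubgroup d

/-- The Poincaré group acts on the points of Minkowski space by affine maps. -/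
instance (d : ℕ) : MulAction (Poincare d) (Minkowski d) where
  smul g x := g.1 x
  one_smul _ := rfl
  mul_smul _ _ _ := rfl

/-- The subgroup of spacetime translations. -/
def translations (d : ℕ) : Subgroup (Poincare d) where
  carrier := {g | ∀ v : Minkowski d, g.1.linear v = v}
  one_mem' := fun _ => rfl
  mul_mem' := by
    intro a b ha hb v
    have : (a * b).1.linear v = a.1.linear (b.1.linear v) := rfl
    rw [this, hb, ha]
  inv_mem' := by
    intro a ha v
    have : (a⁻¹).1.linear v = a.1.linear.symm v := rfl
    rw [this, LinearEquiv.symm_apply_eq, ha]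

/-- The hyperboloid of future-directed unit timelike vectors. -/
def Timelike (d : ℕ) : Type := {v : Minkowski d // eta v v = -1 ∧ 0 < v 0}

/-- The hyperboloid of unit spacelike vectors. -/
def Spacelike (d : ℕ) : Type := {v : Minkowski d // eta v v = 1}

instance (d : ℕ) : MeasurableSpace (Timelike d) := Subtype.instMeasurableSpace

instance (d : ℕ) : MeasurableSpace (Spacelike d) := Subtype.instMeasurableSpace

/-- The Poincaré group acts on directions through its linear part. -/
instance (d : ℕ) : MulAction (Poincare d) (Timelike d) where
  smul g v := ⟨g.1.linear v.1, by
    obtain ⟨L, hL, h⟩ := g.2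
    rw [h]
    exact ⟨(eta_lorentz hL _ _).trans v.2.1, future_lorentz hL v.2.1 v.2.2⟩⟩
  one_smul _ := rfl
  mul_smul _ _ _ := rfl

/-- The Poincaré group acts on directions through its linear part. -/
instance (d : ℕ) : MulAction (Poincare d) (Spacelike d) where
  smul g v := ⟨g.1.linear v.1, by
    obtain ⟨L, hL, h⟩ := g.2
    rw [h]
    exact (eta_lorentz hL _ _).trans v.2⟩
  one_smul _ := rfl
  mul_smul _ _ _ := rfl

/-- Two `k`-tuples of directions, each direction timelike or spacelike, are identified when they
differ by a permutation of the entries that belongs to `S`. -/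
def permSetoid (d : ℕ) {k : ℕ} (S : Subgroup (Equiv.Perm (Fin k))) :
    Setoid (Fin k → Timelike d ⊕ Spacelike d) where
  r v w := ∃ s ∈ S, w = v ∘ s
  iseqv :=
    { refl := fun _ => ⟨1, one_mem _, rfl⟩
      symm := by
        rintro v w ⟨s, hs, rfl⟩
        refine ⟨s⁻¹, inv_mem hs, ?_⟩
        ext1 i
        simp
      trans := by
        rintro u v w ⟨s, hs, rfl⟩ ⟨t, ht, rfl⟩
        exact ⟨s * t, mul_mem hs ht, rfl⟩ }

/-- Families of `k` directions modulo the permutation group `S`, with the quotient σ-algebra. For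
`S = ⊥` these are ordered tuples (such as frames), for `S = ⊤` unordered ones. -/
def Directions (d : ℕ) {k : ℕ} (S : Subgroup (Equiv.Perm (Fin k))) : Type :=
  Quotient (permSetoid d S)

instance (d : ℕ) {k : ℕ} (S : Subgroup (Equiv.Perm (Fin k))) : MeasurableSpace (Directions d S) :=
  Quotient.instMeasurableSpace

instance (d : ℕ) {k : ℕ} (S : Subgroup (Equiv.Perm (Fin k))) :
    MulAction (Poincare d) (Directions d S) where
  smul g := Quotient.map (sa := permSetoid d S) (sb := permSetoid d S) (fun v i => g • v i) (by
    rintro v w ⟨s, hs, rfl⟩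
    exact ⟨s, hs, rfl⟩)
  one_smul := by
    rintro ⟨v⟩
    exact congrArg (Quotient.mk (permSetoid d S)) (funext fun i => one_smul _ (v i))
  mul_smul := by
    rintro a b ⟨v⟩
    exact congrArg (Quotient.mk (permSetoid d S)) (funext fun i => mul_smul a b (v i))

/-- The space `Ω` of possible sprinklings: the locally finite sets of points. -/
def Omega (d : ℕ) : Type :=
  {w : Set (Minkowski d) // ∀ K : Set (Minkowski d), IsCompact K → (w ∩ K).Finite}

/-- The number of sprinkled points in a region. -/
def count {d : ℕ} (B : Set (Minkowski d)) (w : Omega d) : ℕ∞ := (w.1 ∩ B).encard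

/-- The σ-algebra on `Ω` generated by the numbers of points in Borel sets. -/
instance (d : ℕ) : MeasurableSpace (Omega d) :=
  ⨆ (B : Set (Minkowski d)) (_ : MeasurableSet B), MeasurableSpace.comap (count B) ⊤

/-- The Poincaré group acts on sprinklings by moving each of their points. -/
instance (d : ℕ) : MulAction (Poincare d) (Omega d) where
  smul g w := ⟨g.1 '' w.1, by
    intro K hK
    have hc : Continuous (g.1.symm : Minkowski d → Minkowski d) :=
      AffineMap.continuous_of_finiteDimensional g.1.symm.toAffineMap
    refine ((w.2 _ (hK.image hc)).image g.1).subset ?_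
    rintro _ ⟨⟨x, hx, rfl⟩, hxK⟩
    exact ⟨x, ⟨hx, g.1 x, hxK, by simp⟩, rfl⟩⟩
  one_smul w := Subtype.ext (Set.image_id w.1)
  mul_smul a b w := Subtype.ext (Set.image_comp a.1 b.1 w.1)

/-- `μ` is the law of the Poisson process of density `ρ`: the number of points in a Borel set of
finite volume `V` has the Poisson distribution with mean `ρ V`, and the numbers of points in
disjoint such sets are independent. -/
structure IsPoisson {d : ℕ} (ρ : ℝ) (μ : Measure (Omega d)) : Prop where
  isProbabilityMeasure : IsProbabilityMeasure μ
  count_eq : ∀ B : Set (Minkowski d), MeasurableSet B → volume B ≠ ⊤ → ∀ k : ℕ,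
    μ {w | count B w = k} = ENNReal.ofReal
      ((ρ * (volume B).toReal) ^ k * Real.exp (-(ρ * (volume B).toReal)) / (k.factorial : ℝ))
  indep : ∀ (m : ℕ) (B : Fin m → Set (Minkowski d)), (∀ i, MeasurableSet (B i)) →
    (∀ i, volume (B i) ≠ ⊤) → Pairwise (fun i j => Disjoint (B i) (B j)) →
    iIndepFun (fun i => count (B i)) μ

/-- Some `G`-equivariant measurable rule, defined at least on a set `A` of nonzero measure, assigns
elements of `Y` to elements of `X`. It is only asked to commute with those transformations that do
not lead out of `A`; if `A` is `G`-invariant, in particular if `A` is everything, this is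
equivariance in the full sense. -/
def Determines {d : ℕ} {X : Type} [MeasurableSpace X] [MulAction (Poincare d) X] (ν : Measure X)
    (G : Subgroup (Poincare d)) (Y : Type) [MeasurableSpace Y] [MulAction (Poincare d) Y] : Prop :=
  ∃ A : Set X, MeasurableSet A ∧ ν A ≠ 0 ∧ ∃ D : A → Y, Measurable D ∧
    ∀ g ∈ G, ∀ (x : X) (hx : x ∈ A) (hgx : g • x ∈ A), D ⟨g • x, hgx⟩ = g • D ⟨x, hx⟩

end Sprinkling

end

open Sprinkling

noncomputable section

namespace Sprinkling

/-! The proof is Poincaré recurrence. Each Poincaré transformation `g` preserves the probability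
measure `μ`. If an equivariant rule took values with positive probability in a set `E` to which no
positive power of `g` leads back, then almost every sprinkling with value in `E` would return to
such sprinklings under some `g ^ m`, and its value would return to `E`: a contradiction. So if
countably many wandering sets, each for one of countably many transformations, cover `Y`, the domain
of the rule is null (`not_determines_of_wandering`).

For locations the wandering sets are unit time slabs, moved by a translation. For directions, a
boost doubles a null coordinate `v⁰ ± vⁱ`, so the dyadic shells of its absolute value wander; a
nonzero vector has some nonzero null coordinate, so finitely many boosts suffice. For a family
modulo permutations the absolute values are summed over its entries. All these boosts fix the given
point, so the stabilizer is enough and the full group follows by restriction. With a variable point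
the product measure is infinite and recurrence does not apply directly, but by Fubini some slice at
a fixed point is non-null, and the rule restricts to it.

Invariance of `μ` comes from its void probabilities `exp (-ρ V)`: void events form a π-system
generating the σ-algebra, and Poincaré maps preserve volume. -/

/-! ### The σ-algebra of sprinklings is generated by the void events -/

/-- The index of the cubical cell of side `1 / (m + 1)` that contains a point. -/
def cell {d : ℕ} (m : ℕ) (x : Minkowski d) : Fin (d + 1) → ℤ := fun i => ⌊((m : ℝ) + 1) * x i⌋

theorem measurable_cell {d : ℕ} (m : ℕ) : Measurable (cell (d := d) m) :=
  measurable_pi_lambda _ fun i =>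
    Int.measurable_floor.comp (measurable_const.mul (measurable_pi_apply i))

theorem volume_cell_ne_top {d : ℕ} (m : ℕ) (q : Fin (d + 1) → ℤ) :
    volume (cell (d := d) m ⁻¹' {q}) ≠ ⊤ := by
  have hm : (0 : ℝ) < (m : ℝ) + 1 := by positivity
  refine ne_top_of_le_ne_top (isCompact_Icc (a := fun i => (q i : ℝ) / ((m : ℝ) + 1))
    (b := fun i => ((q i : ℝ) + 1) / ((m : ℝ) + 1))).measure_lt_top.ne (measure_mono ?_)
  rintro x rfl
  refine ⟨fun i => ?_, fun i => ?_⟩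
  · rw [div_le_iff₀ hm, mul_comm]
    exact Int.floor_le _
  · rw [le_div_iff₀ hm, mul_comm]
    exact (Int.lt_floor_add_one _).le

theorem eventually_cell_ne {d : ℕ} {x y : Minkowski d} (h : x ≠ y) :
    ∀ᶠ m : ℕ in Filter.atTop, cell m x ≠ cell m y := by
  obtain ⟨i, hi⟩ := Function.ne_iff.mp h
  have hpos : 0 < |x i - y i| := abs_pos.mpr (sub_ne_zero.mpr hi)
  obtain ⟨N, hN⟩ := exists_nat_gt (1 / |x i - y i|)
  rw [div_lt_iff₀ hpos] at hN
  filter_upwards [Filter.eventually_ge_atTop N] with m hm heq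
  have h1 : |((m : ℝ) + 1) * x i - ((m : ℝ) + 1) * y i| < 1 :=
    Int.abs_sub_lt_one_of_floor_eq_floor (congrFun heq i)
  rw [← mul_sub, abs_mul, abs_of_pos (by positivity : (0 : ℝ) < (m : ℝ) + 1)] at h1
  have h2 : (N : ℝ) ≤ m := by exact_mod_cast hm
  nlinarith

/-- Only finitely many pairs have to be separated, and each is separated by every sufficiently fine
grid. -/
theorem exists_injOn_cell {d : ℕ} (F : Finset (Minkowski d)) :
    ∃ m, Set.InjOn (cell m) (F : Set (Minkowski d)) := by
  have h : ∀ᶠ m : ℕ in Filter.atTop, ∀ x ∈ F, ∀ y ∈ F, x ≠ y → cell m x ≠ cell m y := by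
    rw [Filter.eventually_all_finset]
    intro x _
    rw [Filter.eventually_all_finset]
    intro y _
    by_cases hxy : x = y
    · simp [hxy]
    · filter_upwards [eventually_cell_ne hxy] with m hm _ using hm
  obtain ⟨m, hm⟩ := h.exists
  exact ⟨m, fun x hx y hy hxy => by_contra fun hne => hm x hx y hy hne hxy⟩

/-- The events that a region of finite volume contains no sprinkled point. -/
def voidEvents (d : ℕ) : Set (Set (Omega d)) :=
  {S | ∃ B : Set (Minkowski d), MeasurableSet B ∧ volume B ≠ ⊤ ∧ S = {w | count B w = 0}}

theorem isPiSystem_voidEvents (d : ℕ) : IsPiSystem (voidEvents d) := by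
  rintro _ ⟨B, hB, hB', rfl⟩ _ ⟨C, hC, hC', rfl⟩ -
  refine ⟨B ∪ C, hB.union hC, (measure_union_lt_top hB'.lt_top hC'.lt_top).ne, ?_⟩
  ext w
  simp [count, Set.inter_union_distrib_left]

/-- At least `n` points lie in `B` exactly when, for some grid, `n` different cells are occupied
inside `B`. This writes a counting event through void events by countable operations. -/
theorem setOf_le_count {d : ℕ} (B : Set (Minkowski d)) (n : ℕ) :
    {w : Omega d | (n : ℕ∞) ≤ count B w} =
      ⋃ (m : ℕ) (s : Finset (Fin (d + 1) → ℤ)) (_ : s.card = n),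
        ⋂ q ∈ s, {w : Omega d | count (B ∩ cell m ⁻¹' {q}) w = 0}ᶜ := by
  ext w
  simp only [Set.mem_ofPred_eq, Set.mem_iUnion, Set.mem_iInter, Set.mem_compl_iff, count,
    Set.encard_eq_zero, ← ne_eq, ← Set.nonempty_iff_ne_empty]
  constructor
  · intro h
    obtain ⟨t, ht, htn⟩ := Set.exists_subset_encard_eq h
    have htf : t.Finite := Set.finite_of_encard_eq_coe htn
    lift t to Finset (Minkowski d) using htf
    obtain ⟨m, hm⟩ := exists_injOn_cell t
    refine ⟨m, t.image (cell m), ?_, ?_⟩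
    · rw [Finset.card_image_of_injOn hm]
      simpa using htn
    · intro q hq
      obtain ⟨x, hx, rfl⟩ := Finset.mem_image.mp hq
      exact ⟨x, (ht hx).1, (ht hx).2, rfl⟩
  · rintro ⟨m, s, rfl, hs⟩
    have hsub : (s : Set (Fin (d + 1) → ℤ)) ⊆ cell m '' (w.1 ∩ B) := by
      intro q hq
      obtain ⟨x, hx, hxB, hxq⟩ := hs q hq
      exact ⟨x, ⟨hx, hxB⟩, hxq⟩
    rw [← Set.encard_coe_eq_coe_finsetCard]
    exact (Set.encard_le_encard hsub).trans (Set.encard_image_le _ _)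

theorem measurableSpace_omega_eq (d : ℕ) :
    instMeasurableSpaceOmega d =
      MeasurableSpace.generateFrom (voidEvents d) := by
  apply le_antisymm
  · refine iSup₂_le fun B hB => ?_
    have hge : ∀ n : ℕ, MeasurableSet[MeasurableSpace.generateFrom (voidEvents d)]
        {w : Omega d | (n : ℕ∞) ≤ count B w} := by
      intro n
      rw [setOf_le_count]
      refine MeasurableSet.iUnion fun m => MeasurableSet.iUnion fun s =>
        MeasurableSet.iUnion fun _ => Finset.measurableSet_biInter _ fun q _ =>
          MeasurableSet.compl (MeasurableSpace.measurableSet_generateFrom ?_)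
      -- Intersecting with a cell makes the volume finite even when that of `B` is not.
      exact ⟨_, hB.inter (measurable_cell m (measurableSet_singleton q)),
        ne_top_of_le_ne_top (volume_cell_ne_top m q) (measure_mono Set.inter_subset_right), rfl⟩
    rw [← measurable_iff_comap_le]
    refine @measurable_to_countable' _ _ ⊤ _ (MeasurableSpace.generateFrom (voidEvents d)) _
      fun k => ?_
    induction k using ENat.recTopCoe with
    | top =>
      have : count B ⁻¹' {(⊤ : ℕ∞)} = ⋂ n : ℕ, {w : Omega d | (n : ℕ∞) ≤ count B w} := by
        ext w
        simp [ENat.eq_top_iff_forall_ge]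
      rw [this]
      exact MeasurableSet.iInter hge
    | coe n =>
      have : count B ⁻¹' {(n : ℕ∞)} =
          {w : Omega d | (n : ℕ∞) ≤ count B w} \ {w | ((n + 1 : ℕ) : ℕ∞) ≤ count B w} := by
        ext w
        simp only [Set.mem_preimage, Set.mem_singleton_iff, Set.mem_sdiff, Set.mem_ofPred_eq]
        cases count B w using ENat.recTopCoe with
        | top => simp
        | coe l =>
          norm_cast
          omega
      rw [this]
      exact (hge n).diff (hge (n + 1))
  · refine MeasurableSpace.generateFrom_le ?_
    rintro _ ⟨B, hB, -, rfl⟩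
    exact (le_iSup₂ (f := fun (B : Set (Minkowski d)) (_ : MeasurableSet B) =>
      MeasurableSpace.comap (count B) ⊤) B hB) _ ⟨{0}, trivial, rfl⟩

/-! ### Invariance of the Poisson process -/

theorem count_smul {d : ℕ} (g : Poincare d) (B : Set (Minkowski d)) (w : Omega d) :
    count B (g • w) = count (g.1 ⁻¹' B) w := by
  change (g.1 '' w.1 ∩ B).encard = _
  rw [← Set.image_inter_preimage, g.1.injective.encard_image]
  rfl

theorem continuous_poincare {d : ℕ} (g : Poincare d) : Continuous (g.1 : Minkowski d → Minkowski d) :=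
  AffineMap.continuous_of_finiteDimensional g.1.toAffineMap

theorem measurable_smul_omega {d : ℕ} (g : Poincare d) :
    Measurable fun w : Omega d => g • w := by
  rw [measurable_iff_comap_le]
  -- Only the target σ-algebra is replaced, so that preimages need checking for void events alone.
  conv_lhs => rw [show instMeasurableSpaceOmega d = _ from
    measurableSpace_omega_eq d]
  rw [← measurable_iff_comap_le]
  refine measurable_generateFrom ?_
  rintro _ ⟨B, hB, -, rfl⟩
  simp only [Set.preimage_ofPred_eq, count_smul]
  exact (le_iSup₂ (f := fun (B : Set (Minkowski d)) (_ : MeasurableSet B) =>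
      MeasurableSpace.comap (count B) ⊤) _ ((continuous_poincare g).measurable hB))
      _ ⟨{0}, trivial, rfl⟩

/-- The Gram matrix of the Minkowski inner product. -/
def etaMatrix (d : ℕ) : Matrix (Fin (d + 1)) (Fin (d + 1)) ℝ :=
  Matrix.diagonal (Fin.cons (-1) fun _ => 1)

theorem eta_eq_dotProduct {d : ℕ} (v w : Minkowski d) :
    eta v w = v ⬝ᵥ (etaMatrix d).mulVec w := by
  simp [eta, etaMatrix, dotProduct, Fin.sum_univ_succ, Matrix.mulVec_diagonal]

/-- Take determinants in `Mᵀ η M = η` and cancel `det η ≠ 0`. -/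
theorem abs_det_fullLorentz {d : ℕ} {L : GL (Fin (d + 1)) ℝ} (hL : L ∈ fullLorentz d) :
    |(L : Matrix (Fin (d + 1)) (Fin (d + 1)) ℝ).det| = 1 := by
  set M := (L : Matrix (Fin (d + 1)) (Fin (d + 1)) ℝ)
  have h : M.transpose * etaMatrix d * M = etaMatrix d := by
    apply Matrix.ext_of_mulVec_single
    intro j
    refine dotProduct_eq _ _ fun v => ?_
    rw [dotProduct_comm, dotProduct_comm _ v, ← eta_eq_dotProduct, ← hL, eta_eq_dotProduct,
      ← Matrix.mulVec_mulVec, ← Matrix.mulVec_mulVec, Matrix.dotProduct_mulVec,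
      Matrix.vecMul_transpose]
  have hdet := congrArg Matrix.det h
  have hne : (etaMatrix d).det ≠ 0 := by
    simp [etaMatrix, Matrix.det_diagonal, Fin.prod_univ_succ]
  rw [Matrix.det_mul, Matrix.det_mul, Matrix.det_transpose] at hdet
  have hsq : M.det ^ 2 = 1 := by
    apply mul_right_cancel₀ hne
    linarith
  rw [← sq_eq_sq₀ (abs_nonneg _) zero_le_one, sq_abs, hsq, one_pow]

theorem volume_preimage_poincare {d : ℕ} (g : Poincare d) (B : Set (Minkowski d)) :
    volume (g.1 ⁻¹' B) = volume B := by
  obtain ⟨L, ⟨M, -, rfl⟩, hLg⟩ := g.2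
  have hdet := abs_det_fullLorentz M.2
  set N := ((M : GL (Fin (d + 1)) ℝ) : Matrix (Fin (d + 1)) (Fin (d + 1)) ℝ)
  have hdec : (g.1 : Minkowski d → Minkowski d) = (fun y => y + g.1 0) ∘ (Matrix.toLin' N) := by
    funext v
    have := g.1.map_vadd 0 v
    simp only [vadd_eq_add, add_zero, hLg] at this
    simpa [Matrix.toLin'_apply] using this
  rw [hdec, Set.preimage_comp, Measure.addHaar_preimage_linearMap, measure_preimage_add_right]
  · rw [LinearMap.det_toLin', abs_inv, hdet]
    simp
  · rw [LinearMap.det_toLin']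
    intro h0
    rw [h0] at hdet
    simp at hdet

/-- The law of the Poisson process is invariant under the Poincaré group. -/
theorem IsPoisson.measurePreserving_smul {d : ℕ} {ρ : ℝ} {μ : Measure (Omega d)}
    (hμ : IsPoisson ρ μ) (g : Poincare d) : MeasurePreserving (fun w : Omega d => g • w) μ μ := by
  have := hμ.isProbabilityMeasure
  refine ⟨measurable_smul_omega g, ?_⟩
  have := Measure.isProbabilityMeasure_map (μ := μ) (measurable_smul_omega g).aemeasurable
  refine ext_of_generate_finite (voidEvents d) (measurableSpace_omega_eq d)
    (isPiSystem_voidEvents d) ?_ (by simp)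
  rintro _ ⟨B, hB, hB', rfl⟩
  have hmeas : MeasurableSet {w : Omega d | count B w = 0} := by
    change MeasurableSet[inferInstance] _
    rw [measurableSpace_omega_eq d]
    exact MeasurableSpace.measurableSet_generateFrom ⟨B, hB, hB', rfl⟩
  rw [Measure.map_apply (measurable_smul_omega g) hmeas]
  simp only [Set.preimage_ofPred_eq, count_smul]
  have h1 := hμ.count_eq B hB hB' 0
  have h2 := hμ.count_eq (g.1 ⁻¹' B) ((continuous_poincare g).measurable hB)
    (by rwa [volume_preimage_poincare]) 0
  rw [volume_preimage_poincare] at h2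
  simpa using h2.trans h1.symm

/-! ### Poincaré recurrence against wandering sets -/

/-- An equivariant rule on a finite measure space almost never takes its values in a countable union
of sets to which no positive power of a given group element leads back. -/
theorem measure_equivariant_mem_wandering_eq_zero {d : ℕ} {X : Type} [MeasurableSpace X]
    [MulAction (Poincare d) X] {ν : Measure X} [IsFiniteMeasure ν] {G : Subgroup (Poincare d)}
    {Y : Type} [MeasurableSpace Y] [MulAction (Poincare d) Y] {A : Set X} (hA : MeasurableSet A)
    {D : A → Y} (hD : Measurable D)
    (hG : ∀ g ∈ G, ∀ (x : X) (hx : x ∈ A) (hgx : g • x ∈ A), D ⟨g • x, hgx⟩ = g • D ⟨x, hx⟩)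
    {g : Poincare d} (hg : g ∈ G) (hpres : MeasurePreserving (fun x : X => g • x) ν ν)
    {ι : Type*} [Countable ι] {E : ι → Set Y} (hE : ∀ j, MeasurableSet (E j))
    (hwander : ∀ j, ∀ y ∈ E j, ∀ m : ℕ, m ≠ 0 → g ^ m • y ∉ E j) :
    ν (Subtype.val '' (D ⁻¹' ⋃ j, E j)) = 0 := by
  rw [Set.preimage_iUnion, Set.image_iUnion, measure_iUnion_null_iff]
  intro j
  by_contra hne
  have hmeas : MeasurableSet (Subtype.val '' (D ⁻¹' E j)) := hA.subtype_image (hD (hE j))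
  -- Poincaré recurrence: a measure-preserving map of a finite measure space is conservative.
  obtain ⟨_, ⟨x, hx, rfl⟩, m, hm, y, hy, hyx⟩ :=
    hpres.conservative.exists_mem_iterate_mem hmeas.nullMeasurableSet hne
  rw [smul_iterate] at hyx
  have hmem : g ^ m • x.1 ∈ A := by simpa only [hyx] using y.2
  have hyeq : y = ⟨g ^ m • x.1, hmem⟩ := Subtype.ext hyx
  -- Equivariance is applied to `g ^ m` at once, since the intermediate points of the orbit may
  -- leave `A`.
  rw [hyeq, Set.mem_preimage, hG _ (pow_mem hg m) x.1 x.2 hmem] at hy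
  exact hwander j _ hx m hm hy

/-- A rule cannot be equivariant if, for some countable family of group elements, each value lies in
a set to which no positive power of one of them leads back. -/
theorem not_determines_of_wandering {d : ℕ} {X : Type} [MeasurableSpace X]
    [MulAction (Poincare d) X] {ν : Measure X} [IsFiniteMeasure ν] {G : Subgroup (Poincare d)}
    {Y : Type} [MeasurableSpace Y] [MulAction (Poincare d) Y]
    {κ : Type*} [Countable κ] (g : κ → Poincare d) (hg : ∀ a, g a ∈ G)
    (hpres : ∀ a, MeasurePreserving (fun x : X => g a • x) ν ν)
    {ι : Type*} [Countable ι] (E : κ → ι → Set Y) (hE : ∀ a j, MeasurableSet (E a j))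
    (hwander : ∀ a j, ∀ y ∈ E a j, ∀ m : ℕ, m ≠ 0 → g a ^ m • y ∉ E a j)
    (hcover : ∀ y, ∃ a j, y ∈ E a j) : ¬ Determines ν G Y := by
  rintro ⟨A, hA, hne, D, hD, hG⟩
  refine hne (measure_mono_null (fun x hx => ?_) (measure_iUnion_null fun a =>
    measure_equivariant_mem_wandering_eq_zero hA hD hG (hg a) (hpres a) (hE a) (hwander a)))
  obtain ⟨a, j, haj⟩ := hcover (D ⟨x, hx⟩)
  exact Set.mem_iUnion.mpr ⟨a, ⟨x, hx⟩, Set.mem_iUnion.mpr ⟨j, haj⟩, rfl⟩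

theorem Determines.mono {d : ℕ} {X : Type} [MeasurableSpace X] [MulAction (Poincare d) X]
    {ν : Measure X} {G H : Subgroup (Poincare d)} {Y : Type} [MeasurableSpace Y]
    [MulAction (Poincare d) Y] (h : Determines ν G Y) (hHG : H ≤ G) : Determines ν H Y := by
  obtain ⟨A, hA, hne, D, hD, hG⟩ := h
  exact ⟨A, hA, hne, D, hD, fun g hg => hG g (hHG hg)⟩

/-- A rule for variable points restricts to a rule at some fixed point. -/
theorem Determines.exists_stabilizer {d : ℕ} {X : Type} [MeasurableSpace X]
    [MulAction (Poincare d) X] {ν : Measure X} [SFinite ν] {Y : Type} [MeasurableSpace Y]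
    [MulAction (Poincare d) Y]
    (h : Determines (ν.prod (volume : Measure (Minkowski d))) (⊤ : Subgroup (Poincare d)) Y) :
    ∃ x : Minkowski d, Determines ν (MulAction.stabilizer (Poincare d) x) Y := by
  obtain ⟨A, hA, hne, D, hD, hG⟩ := h
  have hx : ∃ x : Minkowski d, ν ((fun w => (w, x)) ⁻¹' A) ≠ 0 := by
    by_contra! hall
    exact hne (by simp [Measure.prod_apply_symm hA, hall])
  obtain ⟨x, hx⟩ := hx
  refine ⟨x, (fun w => (w, x)) ⁻¹' A, measurable_prodMk_right hA, hx, fun w => D ⟨(w.1, x), w.2⟩,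
    hD.comp ((measurable_prodMk_right.comp measurable_subtype_coe).subtype_mk), ?_⟩
  intro g hg w hw hgw
  have hgx : g • x = x := hg
  -- Because `g` fixes `x`, it moves points of the slice within the slice.
  have hpair : g • (w, x) = (g • w, x) := Prod.ext rfl hgx
  have key := hG g trivial (w, x) hw (by rw [hpair]; exact hgw)
  rw [← key]
  exact congrArg D (Subtype.ext hpair.symm)

/-! ### Translations -/

/-- The translation by a given vector. -/
def translation {d : ℕ} (a : Minkowski d) : Poincare d :=
  ⟨AffineEquiv.constVAdd ℝ (Minkowski d) a, 1, one_mem _, fun v => by simp⟩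

theorem translation_mem {d : ℕ} (a : Minkowski d) : translation a ∈ translations d := fun _ => rfl

theorem translation_smul {d : ℕ} (a x : Minkowski d) : translation a • x = a + x := rfl

theorem translation_pow_smul {d : ℕ} (a x : Minkowski d) (m : ℕ) :
    translation a ^ m • x = (m : ℝ) • a + x := by
  induction m with
  | zero => simp
  | succ m ih =>
    rw [pow_succ', mul_smul, ih, translation_smul]
    push_cast
    module

theorem IsPoisson.not_determines_location {d : ℕ} {ρ : ℝ} {μ : Measure (Omega d)}
    (hμ : IsPoisson ρ μ) : ¬ Determines μ (translations d) (Minkowski d) := by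
  have := hμ.isProbabilityMeasure
  -- The translation raises the time coordinate by one, hence its `m`-th power raises the floor by
  -- `m`.
  refine not_determines_of_wandering (κ := Unit) (fun _ => translation fun _ => 1)
    (fun _ => translation_mem _) (fun _ => hμ.measurePreserving_smul _)
    (ι := ℤ) (fun _ j => {x | ⌊x 0⌋ = j}) ?_ ?_ fun y => ⟨(), _, rfl⟩
  · intro _ j
    exact (Int.measurable_floor.comp (measurable_pi_apply 0)) (measurableSet_singleton j)
  · rintro _ j y rfl m hm h
    rw [translation_pow_smul] at h
    simp at h
    exact hm h

/-! ### Boosts -/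

/-- The matrix of the boost of rapidity `s` in the direction of the `i`-th space coordinate. -/
def boostMatrix {d : ℕ} (i : Fin d) (s : ℝ) : Matrix (Fin (d + 1)) (Fin (d + 1)) ℝ :=
  1 + ((Real.cosh s - 1) • (Matrix.single 0 0 1 + Matrix.single i.succ i.succ 1) +
    Real.sinh s • (Matrix.single 0 i.succ 1 + Matrix.single i.succ 0 1))

theorem boostMatrix_mulVec_zero {d : ℕ} (i : Fin d) (s : ℝ) (v : Minkowski d) :
    (boostMatrix i s).mulVec v 0 = Real.cosh s * v 0 + Real.sinh s * v i.succ := by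
  simp [boostMatrix, Matrix.add_mulVec, Matrix.single_mulVec, Function.update,
    (Fin.succ_ne_zero i).symm]
  ring

theorem boostMatrix_mulVec_self {d : ℕ} (i : Fin d) (s : ℝ) (v : Minkowski d) :
    (boostMatrix i s).mulVec v i.succ = Real.sinh s * v 0 + Real.cosh s * v i.succ := by
  simp [boostMatrix, Matrix.add_mulVec, Matrix.single_mulVec, Function.update]
  ring

theorem boostMatrix_mulVec_of_ne {d : ℕ} {i j : Fin d} (hij : j ≠ i) (s : ℝ) (v : Minkowski d) :
    (boostMatrix i s).mulVec v j.succ = v j.succ := by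
  simp [boostMatrix, Matrix.add_mulVec, Matrix.single_mulVec, Function.update,
    hij]

theorem boostMatrix_zero {d : ℕ} (i : Fin d) : boostMatrix i 0 = 1 := by
  simp [boostMatrix]

theorem boostMatrix_mul {d : ℕ} (i : Fin d) (s t : ℝ) :
    boostMatrix i s * boostMatrix i t = boostMatrix i (s + t) := by
  apply Matrix.ext_of_mulVec_single
  intro l
  rw [← Matrix.mulVec_mulVec]
  generalize (Pi.single l 1 : Minkowski d) = v
  funext j
  refine Fin.cases ?_ (fun j => ?_) j
  · rw [boostMatrix_mulVec_zero, boostMatrix_mulVec_zero, boostMatrix_mulVec_zero,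
      boostMatrix_mulVec_self, Real.cosh_add, Real.sinh_add]
    ring
  · by_cases hj : j = i
    · subst hj
      rw [boostMatrix_mulVec_self, boostMatrix_mulVec_zero, boostMatrix_mulVec_self,
        boostMatrix_mulVec_self, Real.cosh_add, Real.sinh_add]
      ring
    · simp only [boostMatrix_mulVec_of_ne hj]

theorem eta_boostMatrix {d : ℕ} (i : Fin d) (s : ℝ) (v w : Minkowski d) :
    eta ((boostMatrix i s).mulVec v) ((boostMatrix i s).mulVec w) = eta v w := by
  simp only [eta, ← Finset.add_sum_erase _ _ (Finset.mem_univ i)]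
  rw [Finset.sum_congr rfl fun j hj => by
    rw [boostMatrix_mulVec_of_ne (Finset.ne_of_mem_erase hj),
      boostMatrix_mulVec_of_ne (Finset.ne_of_mem_erase hj)]]
  rw [boostMatrix_mulVec_zero, boostMatrix_mulVec_zero, boostMatrix_mulVec_self,
    boostMatrix_mulVec_self]
  linear_combination (v i.succ * w i.succ - v 0 * w 0) * Real.cosh_sq_sub_sinh_sq s

/-- The boost of rapidity `s` in the direction of the `i`-th space coordinate. -/
def boostGL {d : ℕ} (i : Fin d) (s : ℝ) : GL (Fin (d + 1)) ℝ where
  val := boostMatrix i s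
  inv := boostMatrix i (-s)
  val_inv := by rw [boostMatrix_mul, add_neg_cancel, boostMatrix_zero]
  inv_val := by rw [boostMatrix_mul, neg_add_cancel, boostMatrix_zero]

theorem continuous_boostMatrix {d : ℕ} (i : Fin d) : Continuous (boostMatrix i) :=
  continuous_const.add
    (((Real.continuous_cosh.sub continuous_const).smul continuous_const).add
      (Real.continuous_sinh.smul continuous_const))

/-- Varying the rapidity from `0` joins the boost to the identity inside `O(d, 1)`. -/
theorem boostGL_mem_lorentz {d : ℕ} (i : Fin d) (s : ℝ) : boostGL i s ∈ lorentz d := by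
  let f : ℝ → fullLorentz d := fun t => ⟨boostGL i t, fun v w => eta_boostMatrix i t v w⟩
  have hf : Continuous f := by
    have hGL : Continuous (boostGL i) := Units.continuous_iff.mpr
      ⟨continuous_boostMatrix i, (continuous_boostMatrix i).comp continuous_neg⟩
    exact hGL.subtype_mk _
  have h0 : f 0 = 1 := Subtype.ext (Units.ext (boostMatrix_zero i))
  refine ⟨f s, ?_, rfl⟩
  change f s ∈ connectedComponent (1 : fullLorentz d)
  exact (isPreconnected_range hf).subset_connectedComponent ⟨0, h0⟩ ⟨s, rfl⟩

/-- The boost of rapidity `s` in the direction of the `i`-th space coordinate, about the point `x`. -/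
def boost {d : ℕ} (i : Fin d) (s : ℝ) (x : Minkowski d) : Poincare d :=
  ⟨AffineEquiv.mk' (fun p => (boostMatrix i s).mulVec (p - x) + x)
      (Matrix.toLin'OfInv (boostGL i s).inv_val (boostGL i s).val_inv) x
      (fun p => by simp only [sub_self, Matrix.mulVec_zero, zero_add]; rfl),
    boostGL i s, boostGL_mem_lorentz i s, fun _ => rfl⟩

theorem boost_linear {d : ℕ} (i : Fin d) (s : ℝ) (x v : Minkowski d) :
    (boost i s x).1.linear v = (boostMatrix i s).mulVec v := rfl

theorem boost_mem_stabilizer {d : ℕ} (i : Fin d) (s : ℝ) (x : Minkowski d) :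
    boost i s x ∈ MulAction.stabilizer (Poincare d) x := by
  change (boostMatrix i s).mulVec (x - x) + x = x
  simp

/-! ### Directions -/

/-- The null coordinate `v⁰ ± vⁱ`, where `a` consists of the index `i` and the sign. -/
def nullCoord {d : ℕ} (a : Fin d × ℤˣ) (v : Minkowski d) : ℝ := v 0 + ((a.2 : ℤ) : ℝ) * v a.1.succ

theorem measurable_nullCoord {d : ℕ} (a : Fin d × ℤˣ) : Measurable (nullCoord a) :=
  (measurable_pi_apply 0).add (measurable_const.mul (measurable_pi_apply _))

/-- The boost about `x` that doubles the null coordinate `nullCoord a`. -/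
def doublingBoost {d : ℕ} (a : Fin d × ℤˣ) (x : Minkowski d) : Poincare d :=
  boost a.1 (((a.2 : ℤ) : ℝ) * Real.log 2) x

/-- A boost of rapidity `s` multiplies `v⁰ ± vⁱ` by `exp (±s)`; the sign in the rapidity makes the
factor `exp (log 2)` in both cases. -/
theorem nullCoord_doublingBoost {d : ℕ} (a : Fin d × ℤˣ) (x v : Minkowski d) :
    nullCoord a ((doublingBoost a x).1.linear v) = 2 * nullCoord a v := by
  have h2 : Real.cosh (Real.log 2) + Real.sinh (Real.log 2) = 2 := by
    rw [Real.cosh_add_sinh, Real.exp_log two_pos]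
  obtain ⟨i, ε⟩ := a
  rw [doublingBoost, boost_linear, nullCoord, boostMatrix_mulVec_zero, boostMatrix_mulVec_self,
    nullCoord]
  rcases Int.units_eq_one_or ε with rfl | rfl
  · simp only [Units.val_one, Int.cast_one, one_mul]
    linear_combination (v 0 + v i.succ) * h2
  · simp only [Units.val_neg, Units.val_one, Int.cast_neg, Int.cast_one, neg_mul, one_mul,
      Real.cosh_neg, Real.sinh_neg]
    linear_combination (v 0 - v i.succ) * h2

/-- Half the sum and half the difference of `v⁰ + vⁱ` and `v⁰ - vⁱ` recover `v⁰` and `vⁱ`; a space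
direction is needed to reach `v⁰`. -/
theorem eq_zero_of_nullCoord {d : ℕ} (hd : 1 ≤ d) {v : Minkowski d}
    (h : ∀ a : Fin d × ℤˣ, nullCoord a v = 0) : v = 0 := by
  have key : ∀ i : Fin d, v 0 = 0 ∧ v i.succ = 0 := by
    intro i
    have h1 := h (i, 1)
    have h2 := h (i, -1)
    simp only [nullCoord, Units.val_one, Int.cast_one, one_mul, Units.val_neg, Int.cast_neg,
      neg_mul] at h1 h2
    constructor <;> linarith
  funext j
  exact Fin.cases (key ⟨0, hd⟩).1 (fun i => (key i).2) j

/-- There is no rule with values in a space that carries functions which are doubled by the boosts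
about a point and do not all vanish anywhere. -/
theorem IsPoisson.not_determines_of_doubling {d : ℕ} {ρ : ℝ} {μ : Measure (Omega d)}
    (hμ : IsPoisson ρ μ) (x : Minkowski d) {Y : Type} [MeasurableSpace Y]
    [MulAction (Poincare d) Y] (Q : Fin d × ℤˣ → Y → ℝ) (hQ : ∀ a, Measurable (Q a))
    (hnonneg : ∀ a y, 0 ≤ Q a y) (hdouble : ∀ a y, Q a (doublingBoost a x • y) = 2 * Q a y)
    (hne : ∀ y, ∃ a, Q a y ≠ 0) :
    ¬ Determines μ (MulAction.stabilizer (Poincare d) x) Y := by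
  have := hμ.isProbabilityMeasure
  have hpow : ∀ (a) (m : ℕ) (y), Q a (doublingBoost a x ^ m • y) = 2 ^ m * Q a y := by
    intro a m y
    induction m with
    | zero => simp
    | succ m ih =>
      rw [pow_succ', mul_smul, hdouble, ih]
      ring
  -- The wandering sets are dyadic shells of `Q a`: multiplying by `2 ^ m ≥ 2` leaves a shell, and
  -- the shells exhaust the positive values.
  refine not_determines_of_wandering (fun a => doublingBoost a x)
    (fun a => boost_mem_stabilizer _ _ _) (fun a => hμ.measurePreserving_smul _)
    (ι := ℤ) (fun a j => Q a ⁻¹' Set.Ico ((2 : ℝ) ^ j) (2 ^ (j + 1)))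
    (fun a j => hQ a measurableSet_Ico) ?_ ?_
  · intro a j y hy m hm hmem
    rw [Set.mem_preimage, hpow] at hmem
    have h2 : (2 : ℝ) ≤ 2 ^ m := le_self_pow₀ one_le_two hm
    have h3 : (2 : ℝ) ^ (j + 1) = 2 ^ j * 2 := zpow_add_one₀ two_ne_zero j
    have h4 := hmem.2
    have h5 : (2 : ℝ) ^ j ≤ Q a y := hy.1
    have h6 := hnonneg a y
    nlinarith
  · intro y
    obtain ⟨a, ha⟩ := hne y
    obtain ⟨j, hj⟩ := exists_mem_Ico_zpow ((hnonneg a y).lt_of_ne' ha) one_lt_two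
    exact ⟨a, j, hj⟩

theorem Timelike.ne_zero {d : ℕ} (v : Timelike d) : v.1 ≠ 0 := by
  intro h
  have := v.2.2
  simp [h] at this

theorem Spacelike.ne_zero {d : ℕ} (v : Spacelike d) : v.1 ≠ 0 := by
  intro h
  have := v.2
  simp [h, eta] at this

theorem exists_abs_nullCoord_ne_zero {d : ℕ} (hd : 1 ≤ d) {v : Minkowski d} (hv : v ≠ 0) :
    ∃ a : Fin d × ℤˣ, |nullCoord a v| ≠ 0 := by
  by_contra! h
  exact hv (eq_zero_of_nullCoord hd fun a => abs_eq_zero.mp (h a))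

theorem abs_nullCoord_doublingBoost {d : ℕ} (a : Fin d × ℤˣ) (x v : Minkowski d) :
    |nullCoord a ((doublingBoost a x).1.linear v)| = 2 * |nullCoord a v| := by
  rw [nullCoord_doublingBoost, abs_mul, abs_two]

theorem IsPoisson.not_determines_timelike {d : ℕ} (hd : 1 ≤ d) {ρ : ℝ} {μ : Measure (Omega d)}
    (hμ : IsPoisson ρ μ) (x : Minkowski d) :
    ¬ Determines μ (MulAction.stabilizer (Poincare d) x) (Timelike d) :=
  hμ.not_determines_of_doubling x (fun a v => |nullCoord a v.1|)
    (fun a => ((measurable_nullCoord a).comp measurable_subtype_coe).abs)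
    (fun _ _ => abs_nonneg _) (fun a v => abs_nullCoord_doublingBoost a x v.1)
    fun v => exists_abs_nullCoord_ne_zero hd v.ne_zero

theorem IsPoisson.not_determines_spacelike {d : ℕ} (hd : 1 ≤ d) {ρ : ℝ} {μ : Measure (Omega d)}
    (hμ : IsPoisson ρ μ) (x : Minkowski d) :
    ¬ Determines μ (MulAction.stabilizer (Poincare d) x) (Spacelike d) :=
  hμ.not_determines_of_doubling x (fun a v => |nullCoord a v.1|)
    (fun a => ((measurable_nullCoord a).comp measurable_subtype_coe).abs)
    (fun _ _ => abs_nonneg _) (fun a v => abs_nullCoord_doublingBoost a x v.1)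
    fun v => exists_abs_nullCoord_ne_zero hd v.ne_zero

/-- The vector underlying a timelike or spacelike direction. -/
def dirVec {d : ℕ} : Timelike d ⊕ Spacelike d → Minkowski d :=
  Sum.elim Subtype.val Subtype.val

theorem measurable_dirVec {d : ℕ} : Measurable (dirVec (d := d)) :=
  Measurable.sumElim measurable_subtype_coe measurable_subtype_coe

theorem dirVec_smul {d : ℕ} (g : Poincare d) (v : Timelike d ⊕ Spacelike d) :
    dirVec (g • v) = g.1.linear (dirVec v) := by
  rcases v with v | v <;> rfl

theorem dirVec_ne_zero {d : ℕ} (v : Timelike d ⊕ Spacelike d) : dirVec v ≠ 0 := by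
  rcases v with v | v
  · exact v.ne_zero
  · exact v.ne_zero

/-- The sum of the absolute values of a null coordinate over a family of directions. -/
def nullSum {d k : ℕ} (S : Subgroup (Equiv.Perm (Fin k))) (a : Fin d × ℤˣ) :
    Directions d S → ℝ :=
  Quotient.lift (s := permSetoid d S) (fun v => ∑ j, |nullCoord a (dirVec (v j))|) (by
    rintro v w ⟨s, -, rfl⟩
    exact (Equiv.sum_comp s fun j => |nullCoord a (dirVec (v j))|).symm)

theorem measurable_nullSum {d k : ℕ} (S : Subgroup (Equiv.Perm (Fin k))) (a : Fin d × ℤˣ) :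
    Measurable (nullSum S a) := by
  refine measurable_from_quotient.mpr ?_
  change Measurable fun v : Fin k → Timelike d ⊕ Spacelike d =>
    ∑ j, |nullCoord a (dirVec (v j))|
  exact Finset.measurable_fun_sum _ fun j _ =>
    ((measurable_nullCoord a).comp (measurable_dirVec.comp (measurable_pi_apply j))).abs

/-- Absolute values prevent cancellation, so one entry with a nonzero null coordinate makes the sum
nonzero; `1 ≤ k` supplies an entry. -/
theorem IsPoisson.not_determines_directions {d : ℕ} (hd : 1 ≤ d) {ρ : ℝ} {μ : Measure (Omega d)}
    (hμ : IsPoisson ρ μ) (x : Minkowski d) {k : ℕ} (hk : 1 ≤ k)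
    (S : Subgroup (Equiv.Perm (Fin k))) :
    ¬ Determines μ (MulAction.stabilizer (Poincare d) x) (Directions d S) := by
  refine hμ.not_determines_of_doubling x (nullSum S) (measurable_nullSum S) ?_ ?_ ?_
  · rintro a ⟨v⟩
    exact Finset.sum_nonneg fun _ _ => abs_nonneg _
  · rintro a ⟨v⟩
    change ∑ j, |nullCoord a (dirVec (doublingBoost a x • v j))| =
      2 * ∑ j, |nullCoord a (dirVec (v j))|
    simp only [dirVec_smul, abs_nullCoord_doublingBoost, Finset.mul_sum]
  · rintro ⟨v⟩
    obtain ⟨a, ha⟩ := exists_abs_nullCoord_ne_zero hd (dirVec_ne_zero (v ⟨0, hk⟩))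
    refine ⟨a, fun h => ha ?_⟩
    exact (Finset.sum_eq_zero_iff_of_nonneg fun _ _ => abs_nonneg _).mp h _ (Finset.mem_univ _)

end Sprinkling

end

theorem mainTheorem4 (d : ℕ) (hd : 1 ≤ d) (ρ : ℝ) (hρ : 0 < ρ)
    (μ : Measure (Omega d)) (hμ : IsPoisson ρ μ) :
    -- no preferred location, for the Poincaré group and already for the translations
    (¬ Determines μ (⊤ : Subgroup (Poincare d)) (Minkowski d) ∧
      ¬ Determines μ (translations d) (Minkowski d)) ∧
    -- no preferred direction or finite family of directions, for the Poincaré group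
    (¬ Determines μ (⊤ : Subgroup (Poincare d)) (Timelike d) ∧
      ¬ Determines μ (⊤ : Subgroup (Poincare d)) (Spacelike d) ∧
      ∀ k : ℕ, 1 ≤ k → ∀ S : Subgroup (Equiv.Perm (Fin k)),
        ¬ Determines μ (⊤ : Subgroup (Poincare d)) (Directions d S)) ∧
    -- none at a given point, for the Lorentz group that fixes this point
    (∀ x : Minkowski d,
      ¬ Determines μ (MulAction.stabilizer (Poincare d) x) (Timelike d) ∧
      ¬ Determines μ (MulAction.stabilizer (Poincare d) x) (Spacelike d) ∧
      ∀ k : ℕ, 1 ≤ k → ∀ S : Subgroup (Equiv.Perm (Fin k)),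
        ¬ Determines μ (MulAction.stabilizer (Poincare d) x) (Directions d S)) ∧
    -- none at a point that is moved along with the sprinkling, for the Poincaré group
    (¬ Determines (μ.prod (volume : Measure (Minkowski d)))
        (⊤ : Subgroup (Poincare d)) (Timelike d) ∧
      ¬ Determines (μ.prod (volume : Measure (Minkowski d)))
        (⊤ : Subgroup (Poincare d)) (Spacelike d) ∧
      ∀ k : ℕ, 1 ≤ k → ∀ S : Subgroup (Equiv.Perm (Fin k)),
        ¬ Determines (μ.prod (volume : Measure (Minkowski d)))
          (⊤ : Subgroup (Poincare d)) (Directions d S)) := by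
  have := hμ.isProbabilityMeasure
  refine ⟨⟨fun h => hμ.not_determines_location (h.mono le_top), hμ.not_determines_location⟩,
    -- The origin is an arbitrary choice: restricting to any one stabilizer suffices.
    ⟨fun h => hμ.not_determines_timelike hd 0 (h.mono le_top),
      fun h => hμ.not_determines_spacelike hd 0 (h.mono le_top),
      fun k hk S h => hμ.not_determines_directions hd 0 hk S (h.mono le_top)⟩,
    fun x => ⟨hμ.not_determines_timelike hd x, hμ.not_determines_spacelike hd x,
      fun k hk S => hμ.not_determines_directions hd x hk S⟩, ?_, ?_, ?_⟩
  · intro h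
    obtain ⟨x, hx⟩ := h.exists_stabilizer
    exact hμ.not_determines_timelike hd x hx
  · intro h
    obtain ⟨x, hx⟩ := h.exists_stabilizer
    exact hμ.not_determines_spacelike hd x hx
  · intro k hk S h
    obtain ⟨x, hx⟩ := h.exists_stabilizer
    exact hμ.not_determines_directions hd x hk S hx
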